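/- Let $E=(E^0,E^1,r,s)$ be a directed graph with a countable nonempty set $E^0$ of vertices and a countable set $E^1$ of edges, and let $R$ be a unital commutative ring. Let $L_R(E)$ be the Leavitt path algebra of $E$ over $R$, i.e. the universal (not necessarily unital) associative $R$-algebra generated by elements $v$ ($v\in E^0$) and $e,e^*$ ($e\in E^1$) such that the $v$ are pairwise orthogonal idempotents, $s(e)e=er(e)=e$, $r(e)e^*=e^*s(e)=e^*$, $e^*f=\delta_{e,f}\,r(e)$, and $v=\sum_{s(e)=v}ee^*$ whenever $0<|s^{-1}(v)|<\infty$. It is $\mathbb{Z}$-graded by $L_R(E)_k=\operatorname{span}_R\{\alpha\beta^*:\alpha,\beta\text{ finite paths},\ |\alpha|-|\beta|=k\}$, where vertices are paths of length $0$. All ideals are two-sided. An ideal $I$ of $L_R(E)$ is *graded* if $I=\bigoplus_{k\in\mathbb{Z}}(I\cap L_R(E)_k)$. It is *basic* if, for every $r\in R\setminus\{0\}$ and every $x$ that is either a vertex or of the form $x=v-\sum_{i=1}^n e_ie_i^*$ with $v\in E^0$ and distinct edges $e_1,\dots,e_n$ of source $v$, $rx\in I$ implies $x\in I$. A proper ideal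 $P$ of a ring is *prime* if for all ideals $J_1,J_2$ with $J_1J_2\subseteq P$ one has $J_1\subseteq P$ or $J_2\subseteq P$; a ring is *prime* if its zero ideal is prime (in particular the ring is nonzero). Then the following are equivalent. 1. $L_R(E)$ is a prime ring. 2. $R$ is an integral domain and $E$ satisfies Condition (MT3): for all $v,w\in E^0$ there is $y\in E^0$ such that there are paths (possibly of length $0$) from $v$ to $y$ and from $w$ to $y$. 3. $R$ is an integral domain and $I\cap J\cap E^0\neq\emptyset$ for all nonzero graded basic ideals $I$ and $J$ of $L_R(E)$. -/

import Mathlib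

/-!
A directed graph `E = (E⁰, E¹, r, s)` is a quiver on the vertex type `V = E⁰`.  The set of all
edges is `Quiver.Total V`; the source and the range of an edge `e` are `e.left` and `e.right`.
Paths are `Quiver.Path v w`; the trivial path at `v` has length zero.
-/

universe u v w

/-- Formal generators of a Leavitt path algebra: vertices, real edges `e`, ghost edges `e^*`. -/
inductive LeavittGen (V : Type v) [Quiver.{w} V] : Type (max v w)
  | vertex (x : V) : LeavittGen V
  | edge (e : Quiver.Total V) : LeavittGen V
  | ghost (e : Quiver.Total V) : LeavittGen V

/-- The free (non-unital, associative) `R`-algebra on the generators: the semigroup algebra of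
the free semigroup. -/
abbrev LeavittFree (R : Type u) [CommRing R] (V : Type v) [Quiver.{w} V] : Type (max u v w) :=
  MonoidAlgebra R (FreeSemigroup (LeavittGen V))

/-- A generator, as an element of the free algebra. -/
noncomputable def LeavittFree.of (R : Type u) [CommRing R] {V : Type v} [Quiver.{w} V]
    (x : LeavittGen V) : LeavittFree R V :=
  MonoidAlgebra.single (FreeSemigroup.of x) 1

open LeavittFree LeavittGen in
/-- The defining relations of a Leavitt `E`-family. -/
inductive LeavittRel (R : Type u) [CommRing R] (V : Type v) [Quiver.{w} V] :
    LeavittFree R V → LeavittFree R V → Prop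
  | vertex_idem (x : V) :
      LeavittRel R V (of R (vertex x) * of R (vertex x)) (of R (vertex x))
  | vertex_orth (x y : V) (h : x ≠ y) :
      LeavittRel R V (of R (vertex x) * of R (vertex y)) 0
  | source_edge (e : Quiver.Total V) :
      LeavittRel R V (of R (vertex e.left) * of R (edge e)) (of R (edge e))
  | edge_range (e : Quiver.Total V) :
      LeavittRel R V (of R (edge e) * of R (vertex e.right)) (of R (edge e))
  | range_ghost (e : Quiver.Total V) :
      LeavittRel R V (of R (vertex e.right) * of R (ghost e)) (of R (ghost e))
  | ghost_source (e : Quiver.Total V) :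
      LeavittRel R V (of R (ghost e) * of R (vertex e.left)) (of R (ghost e))
  | ghost_edge_self (e : Quiver.Total V) :
      LeavittRel R V (of R (ghost e) * of R (edge e)) (of R (vertex e.right))
  | ghost_edge_ne (e f : Quiver.Total V) (h : e ≠ f) :
      LeavittRel R V (of R (ghost e) * of R (edge f)) 0
  | vertex_sum (x : V) (s : Finset (Quiver.Total V)) (hs : ∀ e, e ∈ s ↔ e.left = x)
      (hne : s.Nonempty) :
      LeavittRel R V (of R (vertex x)) (∑ e ∈ s, of R (edge e) * of R (ghost e))

/-- The congruence on the free algebra generated by all scalar multiples of the defining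
relations, i.e. the smallest `R`-algebra congruence containing them. -/
noncomputable def leavittCon (R : Type u) [CommRing R] (V : Type v) [Quiver.{w} V] :
    RingCon (LeavittFree R V) :=
  ringConGen fun x y => ∃ (r : R) (a b : LeavittFree R V),
    LeavittRel R V a b ∧ x = r • a ∧ y = r • b

theorem leavittCon_smul {R : Type u} [CommRing R] {V : Type v} [Quiver.{w} V] (r : R)
    {x y : LeavittFree R V} (h : leavittCon R V x y) : leavittCon R V (r • x) (r • y) := by
  change RingConGen.Rel _ x y at h
  induction h with
  | of x y h =>
    obtain ⟨t, a, b, hab, rfl, rfl⟩ := h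
    exact RingConGen.Rel.of _ _ ⟨r * t, a, b, hab, by rw [mul_smul], by rw [mul_smul]⟩
  | refl x => exact RingConGen.Rel.refl _
  | symm _ ih => exact (leavittCon R V).symm ih
  | trans _ _ ih₁ ih₂ => exact (leavittCon R V).trans ih₁ ih₂
  | add _ _ ih₁ ih₂ =>
    rw [smul_add, smul_add]
    exact (leavittCon R V).add ih₁ ih₂
  | mul _ h ih₁ _ =>
    rw [← smul_mul_assoc, ← smul_mul_assoc]
    exact (leavittCon R V).mul ih₁ h

/-- The Leavitt path algebra `L_R(E)`: the universal (non-unital, associative) `R`-algebra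
generated by a Leavitt `E`-family. -/
def LeavittPathAlgebra (R : Type u) [CommRing R] (V : Type v) [Quiver.{w} V] :
    Type (max u v w) :=
  (leavittCon R V).Quotient

namespace LeavittPathAlgebra

section Structure

variable {R : Type u} [CommRing R] {V : Type v} [Quiver.{w} V]

noncomputable instance : NonUnitalRing (LeavittPathAlgebra R V) :=
  inferInstanceAs (NonUnitalRing (leavittCon R V).Quotient)

/-- The quotient map from the free algebra. -/
noncomputable def mk (x : LeavittFree R V) : LeavittPathAlgebra R V := (leavittCon R V).toQuotient x

theorem mk_surjective : Function.Surjective (mk : LeavittFree R V → LeavittPathAlgebra R V) :=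
  Quotient.mk''_surjective

noncomputable instance : SMul R (LeavittPathAlgebra R V) where
  smul r := Quotient.map' (fun x => r • x) fun _ _ h => leavittCon_smul r h

theorem mk_zero : mk (0 : LeavittFree R V) = 0 := rfl

theorem mk_add (x y : LeavittFree R V) : mk (x + y) = mk x + mk y := rfl

theorem mk_mul (x y : LeavittFree R V) : mk (x * y) = mk x * mk y := rfl

theorem mk_smul (r : R) (x : LeavittFree R V) : mk (r • x) = r • mk x := rfl

noncomputable instance : Module R (LeavittPathAlgebra R V) :=
  mk_surjective.module R (⟨⟨mk, mk_zero⟩, mk_add⟩ : LeavittFree R V →+ LeavittPathAlgebra R V)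
    mk_smul

instance : IsScalarTower R (LeavittPathAlgebra R V) (LeavittPathAlgebra R V) where
  smul_assoc r x y := by
    obtain ⟨x, rfl⟩ := mk_surjective x
    obtain ⟨y, rfl⟩ := mk_surjective y
    exact congrArg mk (smul_mul_assoc r x y)

instance : SMulCommClass R (LeavittPathAlgebra R V) (LeavittPathAlgebra R V) where
  smul_comm r x y := by
    obtain ⟨x, rfl⟩ := mk_surjective x
    obtain ⟨y, rfl⟩ := mk_surjective y
    exact congrArg mk (mul_smul_comm r x y).symm

end Structure

section Elements

variable (R : Type u) [CommRing R] {V : Type v} [Quiver.{w} V]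

/-- The element `v` of `L_R(E)`, for a vertex `v`. -/
noncomputable def vertex (x : V) : LeavittPathAlgebra R V :=
  mk (LeavittFree.of R (LeavittGen.vertex x))

/-- The element `e` of `L_R(E)`, for an edge `e`. -/
noncomputable def edge (e : Quiver.Total V) : LeavittPathAlgebra R V :=
  mk (LeavittFree.of R (LeavittGen.edge e))

/-- The element `e^*` of `L_R(E)`, for an edge `e`. -/
noncomputable def ghost (e : Quiver.Total V) : LeavittPathAlgebra R V :=
  mk (LeavittFree.of R (LeavittGen.ghost e))

/-- The element `α = e₁ ⋯ eₙ` of `L_R(E)`, for a path `α`. -/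
noncomputable def realPath {a : V} : {b : V} → Quiver.Path a b → LeavittPathAlgebra R V
  | _, .nil => vertex R a
  | _, .cons p e => realPath p * edge R ⟨_, _, e⟩

/-- The element `α^* = eₙ^* ⋯ e₁^*` of `L_R(E)`, for a path `α`. -/
noncomputable def ghostPath {a : V} : {b : V} → Quiver.Path a b → LeavittPathAlgebra R V
  | _, .nil => vertex R a
  | _, .cons p e => ghost R ⟨_, _, e⟩ * ghostPath p

variable (V) in
/-- The homogeneous component `L_R(E)_k`: the `R`-span of the elements `α β^*` with
`|α| - |β| = k`.  (If the ranges of `α` and `β` differ, then `α β^* = 0`.) -/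
noncomputable def homogeneous (k : ℤ) : Submodule R (LeavittPathAlgebra R V) :=
  Submodule.span R {x | ∃ (a b c : V) (α : Quiver.Path a c) (β : Quiver.Path b c),
    (α.length : ℤ) - (β.length : ℤ) = k ∧ x = realPath R α * ghostPath R β}

end Elements

section Ideals

variable {R : Type u} [CommRing R] {V : Type v} [Quiver.{w} V]

/-- `I` is graded: `I = ⨁ₖ (I ∩ L_R(E)_k)`, i.e. every element of `I` is in exactly one way a
finite sum of homogeneous elements that lie in `I`. -/
def IsGradedIdeal (I : TwoSidedIdeal (LeavittPathAlgebra R V)) : Prop :=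
  ∀ x ∈ I, ∃! f : ℤ →₀ LeavittPathAlgebra R V,
    (∀ k, f k ∈ I ∧ f k ∈ homogeneous R V k) ∧ (f.sum fun _ y => y) = x

/-- `I` is basic: if `r x ∈ I` with `r ≠ 0`, where `x` is a vertex `v` or an element
`v - ∑ eᵢ eᵢ^*` with finitely many edges `eᵢ` of source `v`, then `x ∈ I`. -/
def IsBasicIdeal (I : TwoSidedIdeal (LeavittPathAlgebra R V)) : Prop :=
  ∀ r : R, r ≠ 0 → ∀ x : V,
    (r • vertex R x ∈ I → vertex R x ∈ I) ∧
    ∀ s : Finset (Quiver.Total V), (∀ e ∈ s, e.left = x) →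
      r • (vertex R x - ∑ e ∈ s, edge R e * ghost R e) ∈ I →
        vertex R x - ∑ e ∈ s, edge R e * ghost R e ∈ I

end Ideals

end LeavittPathAlgebra

/-- A two-sided ideal `P` of a (not necessarily unital) ring is prime if it is proper and
`J₁ J₂ ⊆ P` implies `J₁ ⊆ P` or `J₂ ⊆ P` for all two-sided ideals `J₁`, `J₂`. -/
def IsPrimeTwoSidedIdeal {A : Type u} [NonUnitalRing A] (P : TwoSidedIdeal A) : Prop :=
  P ≠ ⊤ ∧ ∀ J₁ J₂ : TwoSidedIdeal A,
    (∀ x ∈ J₁, ∀ y ∈ J₂, x * y ∈ P) → J₁ ≤ P ∨ J₂ ≤ P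

/-- A ring is prime if its zero ideal is prime. -/
def IsPrimeNonUnitalRing (A : Type u) [NonUnitalRing A] : Prop :=
  IsPrimeTwoSidedIdeal (⊥ : TwoSidedIdeal A)

/-- Condition (MT3) for the graph: any two vertices `v`, `w` connect to a common vertex `y`. -/
def ConditionMT3 (V : Type v) [Quiver.{w} V] : Prop :=
  ∀ a b : V, ∃ y : V, Nonempty (Quiver.Path a y) ∧ Nonempty (Quiver.Path b y)

/-! Write A for the algebra. Everything rests on a reduction: a nonzero homogeneous x satisfies a x
b = c v for some a, b in A, some vertex v and some nonzero scalar c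
(`exists_mul_mul_eq_smul_vertex`). It depends on c v ≠ 0 for c ≠ 0 (`smul_vertex_ne_zero`), which is
read off from an explicit representation. Over a domain the reduction also shows that A is
torsion-free.

From (MT3) to primeness: if x A y = 0 with x, y nonzero, then the top components x_m, y_n also
satisfy x_m A y_n = 0 (`top_mul_mul_top_eq_zero`). Reducing both to multiples c v and d w and
joining v, w to a common vertex z by paths p, q gives cd z = p^*(c v)(p q^*)(d w)q = 0, a
contradiction.

From primeness to (MT3): if v and w reach no common vertex, then v A w = 0
(`vertex_mul_mul_vertex_eq_zero`). Zero divisors r s = 0 likewise give (r v) A (s v) = 0.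

For graded basic ideals: under (MT3), a nonzero one contains a vertex by the reduction, hence every
vertex reachable from it, so two such ideals share a vertex. Conversely, if v A w = 0, then I = {z :
z A w = 0} contains v and its right annihilator J contains w. Both are graded and, by
torsion-freeness, basic; a vertex z in both would satisfy z = z z = 0. -/

namespace LeavittPathAlgebra

/-! ### Defining relations and the universal property -/

section Relations

variable (R : Type u) [CommRing R] {V : Type v} [Quiver.{w} V]

theorem mk_eq_of_rel {a b : LeavittFree R V} (h : LeavittRel R V a b) : mk a = mk b :=
  Quotient.sound (RingConGen.Rel.of _ _ ⟨1, a, b, h, (one_smul _ _).symm, (one_smul _ _).symm⟩)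

theorem vertex_mul_self (x : V) : vertex R x * vertex R x = vertex R x :=
  mk_eq_of_rel R (.vertex_idem x)

theorem vertex_mul_of_ne {x y : V} (h : x ≠ y) : vertex R x * vertex R y = 0 :=
  mk_eq_of_rel R (.vertex_orth x y h)

theorem vertex_left_mul_edge (e : Quiver.Total V) : vertex R e.left * edge R e = edge R e :=
  mk_eq_of_rel R (.source_edge e)

theorem edge_mul_vertex_right (e : Quiver.Total V) : edge R e * vertex R e.right = edge R e :=
  mk_eq_of_rel R (.edge_range e)

theorem vertex_right_mul_ghost (e : Quiver.Total V) : vertex R e.right * ghost R e = ghost R e :=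
  mk_eq_of_rel R (.range_ghost e)

theorem ghost_mul_vertex_left (e : Quiver.Total V) : ghost R e * vertex R e.left = ghost R e :=
  mk_eq_of_rel R (.ghost_source e)

theorem ghost_mul_edge_self (e : Quiver.Total V) : ghost R e * edge R e = vertex R e.right :=
  mk_eq_of_rel R (.ghost_edge_self e)

theorem ghost_mul_edge_of_ne {e f : Quiver.Total V} (h : e ≠ f) : ghost R e * edge R f = 0 :=
  mk_eq_of_rel R (.ghost_edge_ne e f h)

theorem vertex_eq_sum (x : V) (s : Finset (Quiver.Total V)) (hs : ∀ e, e ∈ s ↔ e.left = x)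
    (hne : s.Nonempty) : vertex R x = ∑ e ∈ s, edge R e * ghost R e := by
  refine (mk_eq_of_rel R (.vertex_sum x s hs hne)).trans ?_
  exact map_sum (⟨⟨mk, mk_zero⟩, mk_add⟩ : LeavittFree R V →+ LeavittPathAlgebra R V) _ _

end Relations

section Lift

variable {R : Type u} [CommRing R] {V : Type v} [Quiver.{w} V]
  {B : Type*} [Ring B] [Algebra R B]

/-- The homomorphism from the free algebra determined by the images of the generators. -/
noncomputable def liftFree (g : LeavittGen V → B) : LeavittFree R V →ₙₐ[R] B :=
  MonoidAlgebra.liftMagma R (FreeSemigroup.lift g)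

theorem liftFree_of (g : LeavittGen V → B) (x : LeavittGen V) :
    liftFree g (LeavittFree.of R x) = g x := by
  simp [liftFree, LeavittFree.of]

/-- The universal property of the Leavitt path algebra. -/
noncomputable def lift (g : LeavittGen V → B)
    (hg : ∀ a b, LeavittRel R V a b → liftFree g a = liftFree g b) :
    LeavittPathAlgebra R V →ₙₐ[R] B where
  toFun := Quotient.lift (liftFree g) fun x y h => by
    change RingConGen.Rel _ x y at h
    induction h with
    | of x y h =>
      obtain ⟨t, a, b, hab, rfl, rfl⟩ := h
      rw [map_smul, map_smul, hg a b hab]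
    | refl x => rfl
    | symm _ ih => exact ih.symm
    | trans _ _ ih₁ ih₂ => exact ih₁.trans ih₂
    | add _ _ ih₁ ih₂ => rw [map_add, map_add, ih₁, ih₂]
    | mul _ _ ih₁ ih₂ => rw [map_mul, map_mul, ih₁, ih₂]
  map_smul' r x := by
    obtain ⟨x, rfl⟩ := mk_surjective x
    exact map_smul (liftFree g) r x
  map_zero' := map_zero (liftFree g)
  map_add' x y := by
    obtain ⟨x, rfl⟩ := mk_surjective x
    obtain ⟨y, rfl⟩ := mk_surjective y
    exact map_add (liftFree g) x y
  map_mul' x y := by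
    obtain ⟨x, rfl⟩ := mk_surjective x
    obtain ⟨y, rfl⟩ := mk_surjective y
    exact map_mul (liftFree g) x y

theorem lift_mk_of (g : LeavittGen V → B)
    (hg : ∀ a b, LeavittRel R V a b → liftFree g a = liftFree g b) (x : LeavittGen V) :
    lift g hg (mk (LeavittFree.of R x)) = g x :=
  liftFree_of g x

end Lift

/-! ### A representation in which nonzero multiples of vertices survive -/

section Representation

variable (R : Type u) [CommRing R] (V : Type v) [Quiver.{w} V]

/-- For a vertex x that emits edges, the set of pairs (edge from x, natural number) is countably
infinite, so it can be matched with the copies (x, n) of x. Gluing these bijections over all such x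
gives σ. The factor ℕ leaves room for any number of edges, finite or infinite. -/
theorem exists_branching_equiv [Countable (Quiver.Total V)] :
    ∃ σ : Quiver.Total V × ℕ ≃ {x : V × ℕ // ∃ e : Quiver.Total V, e.left = x.1},
      ∀ p, (σ p).1.1 = p.1.left := by
  have h : ∀ x : V, (∃ e : Quiver.Total V, e.left = x) →
      Nonempty ({e : Quiver.Total V // e.left = x} × ℕ ≃ ℕ) := fun x hx => by
    obtain ⟨e, he⟩ := hx
    have : Nonempty {e : Quiver.Total V // e.left = x} := ⟨⟨e, he⟩⟩
    obtain ⟨d⟩ := nonempty_denumerable ({e : Quiver.Total V // e.left = x} × ℕ)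
    exact ⟨Denumerable.eqv _⟩
  let φ := fun (x : V) (hx : ∃ e : Quiver.Total V, e.left = x) => (h x hx).some
  refine ⟨Equiv.ofBijective
    (fun p => ⟨(p.1.left, φ p.1.left ⟨p.1, rfl⟩ (⟨p.1, rfl⟩, p.2)), ⟨p.1, rfl⟩⟩) ⟨?_, ?_⟩,
    fun p => rfl⟩
  · have key : ∀ (x : V) (hx hx') (e f : {e : Quiver.Total V // e.left = x}) (n m : ℕ),
        φ x hx (e, n) = φ x hx' (f, m) → (e.1, n) = (f.1, m) := fun x hx hx' e f n m h => by
      have := (φ x hx).injective h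
      simp_all
    rintro ⟨e, n⟩ ⟨f, m⟩ hp
    simp only [Subtype.mk.injEq, Prod.mk.injEq] at hp
    obtain ⟨h₁, h₂⟩ := hp
    -- The two values of φ live over the propositionally equal sources of e and f; this moves them
    -- to one fibre, where injectivity applies.
    have : ∀ (x : V) (hx : e.left = x) (h), φ e.left ⟨e, rfl⟩ (⟨e, rfl⟩, n) =
        φ x h (⟨e, hx⟩, n) := by rintro _ rfl h; rfl
    replace h₂ := (this _ h₁ ⟨f, rfl⟩).symm.trans h₂
    exact key _ ⟨f, rfl⟩ ⟨f, rfl⟩ _ _ _ _ h₂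
  · rintro ⟨⟨x, n⟩, hx⟩
    obtain ⟨⟨⟨e, he⟩, m⟩, hm⟩ := (φ x hx).surjective n
    refine ⟨(e, m), ?_⟩
    subst he
    exact Subtype.ext (Prod.ext rfl hm)

open Classical in
theorem smul_vertex_ne_zero [Countable (Quiver.Total V)] {r : R} (hr : r ≠ 0) (x : V) :
    r • vertex R x ≠ 0 := by
  obtain ⟨σ, hσ⟩ := exists_branching_equiv V
  -- On the free module with basis V × ℕ, a vertex x projects onto its own copies, an edge e sends
  -- (r(e), n) to σ(e, n), and its ghost undoes this, killing all other basis vectors. Basis vectors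
  -- over sinks lie outside the image of σ and are killed by every ghost.
  let g : LeavittGen V → Module.End R (V × ℕ →₀ R)
    | .vertex x => Finsupp.linearCombination R fun p : V × ℕ =>
        if p.1 = x then Finsupp.single p (1 : R) else 0
    | .edge e => Finsupp.linearCombination R fun p : V × ℕ =>
        if p.1 = e.right then Finsupp.single (σ (e, p.2)).1 (1 : R) else 0
    | .ghost e => Finsupp.linearCombination R fun p : V × ℕ =>
        if h : ∃ f : Quiver.Total V, f.left = p.1 then
          if (σ.symm ⟨p, h⟩).1 = e then Finsupp.single (e.right, (σ.symm ⟨p, h⟩).2) (1 : R) else 0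
        else 0
  have gv : ∀ x (p : V × ℕ), g (.vertex x) (Finsupp.single p 1) =
      if p.1 = x then Finsupp.single p (1 : R) else 0 := fun x p => by simp [g]
  have ge : ∀ e (p : V × ℕ), g (.edge e) (Finsupp.single p 1) =
      if p.1 = e.right then Finsupp.single (σ (e, p.2)).1 (1 : R) else 0 := fun x p => by simp [g]
  have gg : ∀ e q, g (.ghost e) (Finsupp.single (σ q).1 1) =
      if q.1 = e then Finsupp.single (e.right, q.2) (1 : R) else 0 := fun e q => by
    have : ∃ f : Quiver.Total V, f.left = (σ q).1.1 := (σ q).2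
    simp only [g, Finsupp.linearCombination_single, one_smul, dif_pos this, Subtype.coe_eta,
      Equiv.symm_apply_apply]
  have gg' : ∀ e (p : V × ℕ), (¬ ∃ f : Quiver.Total V, f.left = p.1) →
      g (.ghost e) (Finsupp.single p 1) = 0 := fun e p h => by
    simp only [g, Finsupp.linearCombination_single, one_smul, dif_neg h]
  have cases : ∀ p : V × ℕ, (∃ q, p = (σ q).1) ∨ ¬ ∃ f : Quiver.Total V, f.left = p.1 := fun p => by
    by_cases h : ∃ f : Quiver.Total V, f.left = p.1
    · exact .inl ⟨σ.symm ⟨p, h⟩, by simp⟩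
    · exact .inr h
  have ext : ∀ a b : Module.End R (V × ℕ →₀ R), (∀ p, a (Finsupp.single p 1) = b (Finsupp.single p 1)) →
      a = b := fun a b h => Finsupp.lhom_ext' fun p => LinearMap.ext_ring (h p)
  have hrel : ∀ a b, LeavittRel R V a b → liftFree g a = liftFree g b := by
    intro a b h
    induction h with
    | vertex_idem x =>
      simp only [map_mul, liftFree_of]
      refine ext _ _ fun p => ?_
      by_cases h : p.1 = x <;> simp [gv, h]
    | vertex_orth x y hxy =>
      simp only [map_mul, liftFree_of, map_zero]
      refine ext _ _ fun p => ?_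
      by_cases h : p.1 = y <;> simp [gv, h, Ne.symm hxy]
    | source_edge e =>
      simp only [map_mul, liftFree_of]
      refine ext _ _ fun p => ?_
      by_cases h : p.1 = e.right <;> simp [gv, ge, h, hσ]
    | edge_range e =>
      simp only [map_mul, liftFree_of]
      refine ext _ _ fun p => ?_
      by_cases h : p.1 = e.right <;> simp [gv, ge, h]
    | range_ghost e =>
      simp only [map_mul, liftFree_of]
      refine ext _ _ fun p => ?_
      obtain ⟨q, rfl⟩ | h := cases p
      · by_cases h : q.1 = e <;> simp [gv, gg, h]
      · simp [gg' _ _ h]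
    | ghost_source e =>
      simp only [map_mul, liftFree_of]
      refine ext _ _ fun p => ?_
      obtain ⟨q, rfl⟩ | h := cases p
      · by_cases h : q.1 = e
        · simp [gv, gg, h, hσ]
        · by_cases h' : q.1.left = e.left <;> simp [gv, gg, h, hσ, h']
      · by_cases h' : p.1 = e.left <;> simp [gv, gg' _ _ h, h']
    | ghost_edge_self e =>
      simp only [map_mul, liftFree_of]
      refine ext _ _ fun p => ?_
      obtain ⟨p, n⟩ := p
      by_cases h : p = e.right <;> simp [gv, ge, gg, h]
    | ghost_edge_ne e f hef =>
      simp only [map_mul, liftFree_of, map_zero]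
      refine ext _ _ fun p => ?_
      by_cases h : p.1 = f.right <;> simp [ge, gg, h, Ne.symm hef]
    | vertex_sum x s hs hne =>
      simp only [map_sum, map_mul, liftFree_of]
      refine ext _ _ fun p => ?_
      obtain ⟨q, rfl⟩ | h := cases p
      · have : ∀ e, (g (.edge e) * g (.ghost e)) (Finsupp.single (σ q).1 1) =
            if q.1 = e then Finsupp.single (σ q).1 (1 : R) else 0 := fun e => by
          obtain ⟨q, n⟩ := q
          by_cases h : q = e
          · subst h; simp [gg, ge]
          · simp [gg, h]
        -- Exactly one term e e^* can fix the basis vector σ(q), the one for e = q.1, and it occurs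
        -- in the sum iff q.1 has source x.
        simp only [LinearMap.sum_apply, this, gv, hσ, Finset.sum_ite_eq, hs]
      · have hx : p.1 ≠ x := fun hx => by
          obtain ⟨e, he⟩ := hne
          exact h ⟨e, by rw [(hs e).1 he, hx]⟩
        simp [gv, hx, gg' _ _ h]
  intro h0
  have h1 : lift g hrel (r • vertex R x) (Finsupp.single (x, 0) 1) = Finsupp.single (x, 0) r := by
    rw [map_smul, vertex, lift_mk_of, LinearMap.smul_apply, gv]
    simp
  rw [h0, map_zero] at h1
  exact hr (by simpa using h1.symm)

end Representation

/-! ### The ℤ-grading -/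

section Grading

variable (R : Type u) [CommRing R] (V : Type v) [Quiver.{w} V]

open AddMonoidAlgebra in
/-- The homomorphism `x ↦ ∑ₖ xₖ tᵏ` to Laurent polynomials that encodes the grading. -/
noncomputable def gradeHom : LeavittPathAlgebra R V →ₙₐ[R]
    AddMonoidAlgebra (Unitization R (LeavittPathAlgebra R V)) ℤ :=
  -- The coefficients lie in the unitization because `lift` takes values in unital algebras.
  lift (fun
    | .vertex x => single 0 (Unitization.inr (vertex R x))
    | .edge e => single 1 (Unitization.inr (edge R e))
    | .ghost e => single (-1) (Unitization.inr (ghost R e))) <| by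
    intro a b h
    induction h with
    | vertex_idem x =>
      simp only [map_mul, liftFree_of, single_mul_single, ← Unitization.inr_mul, vertex_mul_self,
        add_zero]
    | vertex_orth x y hxy =>
      simp only [map_mul, map_zero, liftFree_of, single_mul_single, ← Unitization.inr_mul,
        vertex_mul_of_ne R hxy, Unitization.inr_zero, single_zero]
    | source_edge e =>
      simp only [map_mul, liftFree_of, single_mul_single, ← Unitization.inr_mul,
        vertex_left_mul_edge, zero_add]
    | edge_range e =>
      simp only [map_mul, liftFree_of, single_mul_single, ← Unitization.inr_mul,
        edge_mul_vertex_right, add_zero]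
    | range_ghost e =>
      simp only [map_mul, liftFree_of, single_mul_single, ← Unitization.inr_mul,
        vertex_right_mul_ghost, zero_add]
    | ghost_source e =>
      simp only [map_mul, liftFree_of, single_mul_single, ← Unitization.inr_mul,
        ghost_mul_vertex_left, add_zero]
    | ghost_edge_self e =>
      simp only [map_mul, liftFree_of, single_mul_single, ← Unitization.inr_mul,
        ghost_mul_edge_self, neg_add_cancel]
    | ghost_edge_ne e f hef =>
      simp only [map_mul, map_zero, liftFree_of, single_mul_single, ← Unitization.inr_mul,
        ghost_mul_edge_of_ne R hef, Unitization.inr_zero, single_zero]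
    | vertex_sum x s hs hne =>
      simp only [map_sum, map_mul, liftFree_of, single_mul_single, ← Unitization.inr_mul,
        add_neg_cancel, vertex_eq_sum R x s hs hne]
      exact map_sum ((singleAddHom (0 : ℤ)).comp
        (Unitization.inrHom R R (LeavittPathAlgebra R V)).toAddMonoidHom) _ _

theorem gradeHom_vertex (x : V) :
    gradeHom R V (vertex R x) = AddMonoidAlgebra.single 0 (Unitization.inr (vertex R x)) :=
  lift_mk_of _ _ _

theorem gradeHom_edge (e : Quiver.Total V) :
    gradeHom R V (edge R e) = AddMonoidAlgebra.single 1 (Unitization.inr (edge R e)) :=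
  lift_mk_of _ _ _

theorem gradeHom_ghost (e : Quiver.Total V) :
    gradeHom R V (ghost R e) = AddMonoidAlgebra.single (-1) (Unitization.inr (ghost R e)) :=
  lift_mk_of _ _ _

variable {V}

theorem gradeHom_realPath {a b : V} (p : Quiver.Path a b) : gradeHom R V (realPath R p) =
    AddMonoidAlgebra.single (p.length : ℤ) (Unitization.inr (realPath R p)) := by
  induction p with
  | nil => simpa [realPath] using gradeHom_vertex R V a
  | cons p e ih =>
    rw [realPath, map_mul, ih, gradeHom_edge, AddMonoidAlgebra.single_mul_single,
      ← Unitization.inr_mul, Quiver.Path.length_cons, Nat.cast_succ]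

theorem gradeHom_ghostPath {a b : V} (p : Quiver.Path a b) : gradeHom R V (ghostPath R p) =
    AddMonoidAlgebra.single (-(p.length : ℤ)) (Unitization.inr (ghostPath R p)) := by
  induction p with
  | nil => simpa [ghostPath] using gradeHom_vertex R V a
  | cons p e ih =>
    rw [ghostPath, map_mul, ih, gradeHom_ghost, AddMonoidAlgebra.single_mul_single,
      ← Unitization.inr_mul, Quiver.Path.length_cons, Nat.cast_succ, neg_add_rev]

variable {R}

theorem gradeHom_of_mem_homogeneous {k : ℤ} {x : LeavittPathAlgebra R V}
    (hx : x ∈ homogeneous R V k) :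
    gradeHom R V x = AddMonoidAlgebra.single k (Unitization.inr x) := by
  induction hx using Submodule.span_induction with
  | mem x h =>
    obtain ⟨a, b, c, α, β, rfl, rfl⟩ := h
    rw [map_mul, gradeHom_realPath, gradeHom_ghostPath, AddMonoidAlgebra.single_mul_single,
      Unitization.inr_mul, sub_eq_add_neg]
  | zero => simp
  | add x y _ _ hx hy => rw [map_add, hx, hy, Unitization.inr_add, AddMonoidAlgebra.single_add]
  | smul r x _ hx => rw [map_smul, hx, Unitization.inr_smul, AddMonoidAlgebra.smul_single]

variable (R V) in
/-- The projection onto the homogeneous component of degree `k`. -/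
noncomputable def component (k : ℤ) : LeavittPathAlgebra R V →ₗ[R] LeavittPathAlgebra R V where
  toFun x := ((gradeHom R V x).coeff k).snd
  map_add' x y := by simp
  map_smul' r x := by simp

theorem component_of_gradeHom {k : ℤ} {x : LeavittPathAlgebra R V}
    (hx : gradeHom R V x = AddMonoidAlgebra.single k (Unitization.inr x)) (l : ℤ) :
    component R V l x = if k = l then x else 0 := by
  change ((gradeHom R V x).coeff l).snd = _
  rw [hx, AddMonoidAlgebra.coeff_single, Finsupp.single_apply]
  split <;> simp

theorem component_of_mem {k : ℤ} {x : LeavittPathAlgebra R V} (hx : x ∈ homogeneous R V k) (l : ℤ) :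
    component R V l x = if k = l then x else 0 :=
  component_of_gradeHom (gradeHom_of_mem_homogeneous hx) l

end Grading

/-! ### Spanning by the elements α β^* and decomposition into components -/

section Spanning

variable {R : Type u} [CommRing R] {V : Type v} [Quiver.{w} V]

variable (R) in
theorem vertex_mul_vertex_eq (x y : V) :
    vertex R x * vertex R y = vertex R x ∨ vertex R x * vertex R y = 0 := by
  by_cases h : x = y
  · subst h; exact .inl (vertex_mul_self R x)
  · exact .inr (vertex_mul_of_ne R h)

variable (R) in
theorem vertex_mul_realPath {a b : V} (p : Quiver.Path a b) :
    vertex R a * realPath R p = realPath R p := by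
  induction p with
  | nil => exact vertex_mul_self R a
  | cons p e ih => rw [realPath, ← mul_assoc, ih]

variable (R) in
theorem realPath_mul_vertex {a b : V} (p : Quiver.Path a b) :
    realPath R p * vertex R b = realPath R p := by
  cases p with
  | nil => exact vertex_mul_self R a
  | cons p e => rw [realPath, mul_assoc]; exact congrArg _ (edge_mul_vertex_right R ⟨_, _, e⟩)

variable (R) in
theorem vertex_mul_ghostPath {a b : V} (p : Quiver.Path a b) :
    vertex R b * ghostPath R p = ghostPath R p := by
  cases p with
  | nil => exact vertex_mul_self R a
  | cons p e =>
    rw [ghostPath, ← mul_assoc]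
    exact congrArg (· * _) (vertex_right_mul_ghost R ⟨_, _, e⟩)

variable (R) in
theorem ghostPath_mul_vertex {a b : V} (p : Quiver.Path a b) :
    ghostPath R p * vertex R a = ghostPath R p := by
  induction p with
  | nil => exact vertex_mul_self R a
  | cons p e ih => rw [ghostPath, mul_assoc, ih]

variable (R) in
theorem realPath_comp {a b c : V} (p : Quiver.Path a b) (q : Quiver.Path b c) :
    realPath R (p.comp q) = realPath R p * realPath R q := by
  induction q with
  | nil => exact (realPath_mul_vertex R p).symm
  | cons q e ih => rw [Quiver.Path.comp_cons, realPath, ih, realPath, mul_assoc]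

variable (R) in
theorem realPath_toPath {a b : V} (e : a ⟶ b) : realPath R e.toPath = edge R ⟨a, b, e⟩ :=
  vertex_left_mul_edge R ⟨a, b, e⟩

variable (R) in
theorem exists_realPath_eq_edge_mul {a b : V} (p : Quiver.Path a b) {n : ℕ}
    (h : p.length = n + 1) : ∃ (c : V) (e : a ⟶ c) (q : Quiver.Path c b),
      q.length = n ∧ realPath R p = edge R ⟨a, c, e⟩ * realPath R q := by
  obtain ⟨c, e, q, hq, rfl⟩ := p.eq_toPath_comp_of_length_eq_succ h
  exact ⟨c, e, q, hq, by rw [realPath_comp, realPath_toPath]⟩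

variable (R) in
theorem vertex_mul_edge_of_ne {x : V} {e : Quiver.Total V} (h : x ≠ e.left) :
    vertex R x * edge R e = 0 := by
  rw [← vertex_left_mul_edge, ← mul_assoc, vertex_mul_of_ne R h, zero_mul]

variable (R) in
theorem ghost_mul_vertex_of_ne {x : V} {e : Quiver.Total V} (h : e.left ≠ x) :
    ghost R e * vertex R x = 0 := by
  rw [← ghost_mul_vertex_left, mul_assoc, vertex_mul_of_ne R h, mul_zero]

variable (R) in
theorem edge_mul_vertex_of_ne {x : V} {e : Quiver.Total V} (h : e.right ≠ x) :
    edge R e * vertex R x = 0 := by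
  rw [← edge_mul_vertex_right, mul_assoc, vertex_mul_of_ne R h, mul_zero]

variable (R) in
theorem ghostPath_mul_realPath_self {a b : V} (p : Quiver.Path a b) :
    ghostPath R p * realPath R p = vertex R b := by
  induction p with
  | nil => exact vertex_mul_self R a
  | @cons b c p e ih =>
    rw [ghostPath, realPath, mul_assoc, ← mul_assoc _ _ (edge R _), ih]
    rw [show vertex R b = vertex R (Quiver.Total.mk b c e).left from rfl, vertex_left_mul_edge,
      ghost_mul_edge_self]

variable (R V) in
/-- The elements `α β^*` for paths `α` and `β` with the same range. -/
def pathPairs : Set (LeavittPathAlgebra R V) :=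
  {x | ∃ (a b c : V) (α : Quiver.Path a c) (β : Quiver.Path b c),
    x = realPath R α * ghostPath R β}

/-- On α β^*, a vertex keeps or kills the product, an edge lengthens α, and a ghost cancels the
first edge of α or, when α is trivial, lengthens β. Induction on words then shows that the α β^*
span everything. -/
theorem gen_mul_mem_span_pathPairs (g : LeavittGen V) {x : LeavittPathAlgebra R V}
    (hx : x ∈ Submodule.span R (pathPairs R V)) :
    mk (LeavittFree.of R g) * x ∈ Submodule.span R (pathPairs R V) := by
  induction hx using Submodule.span_induction with
  | zero => rw [mul_zero]; exact zero_mem _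
  | add x y _ _ hx hy => rw [mul_add]; exact add_mem hx hy
  | smul r x _ hx => rw [mul_smul_comm]; exact Submodule.smul_mem _ _ hx
  | mem x h =>
    obtain ⟨a, b, c, α, β, rfl⟩ := h
    cases g with
    | vertex y =>
      change vertex R y * _ ∈ _
      by_cases h : y = a
      · subst h
        rw [← mul_assoc, vertex_mul_realPath]
        exact Submodule.subset_span ⟨_, _, _, α, β, rfl⟩
      · rw [← vertex_mul_realPath, ← mul_assoc, ← mul_assoc, vertex_mul_of_ne R h]
        simp
    | edge e =>
      change edge R e * _ ∈ _
      obtain ⟨y, z, e⟩ := e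
      by_cases h : z = a
      · subst h
        rw [← mul_assoc, ← realPath_toPath, ← realPath_comp]
        exact Submodule.subset_span ⟨_, _, _, e.toPath.comp α, β, rfl⟩
      · rw [← vertex_mul_realPath, ← mul_assoc, ← mul_assoc, edge_mul_vertex_of_ne R h]
        simp
    | ghost e =>
      change ghost R e * _ ∈ _
      cases hn : α.length with
      | zero =>
        obtain rfl := Quiver.Path.eq_of_length_zero α hn
        obtain rfl := Quiver.Path.eq_nil_of_length_zero α hn
        obtain ⟨y, z, e⟩ := e
        rw [realPath, vertex_mul_ghostPath]
        by_cases h : y = a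
        · subst h
          refine Submodule.subset_span ⟨_, _, _, .nil, β.cons e, ?_⟩
          rw [realPath, vertex_mul_ghostPath, ghostPath]
        · rw [← vertex_mul_ghostPath, ← mul_assoc, ghost_mul_vertex_of_ne R h]
          simp
      | succ n =>
        obtain ⟨d, f, q, -, hq⟩ := exists_realPath_eq_edge_mul R α hn
        rw [hq, ← mul_assoc, ← mul_assoc]
        by_cases h : e = ⟨a, d, f⟩
        · subst h
          rw [ghost_mul_edge_self, vertex_mul_realPath]
          exact Submodule.subset_span ⟨_, _, _, q, β, rfl⟩
        · rw [ghost_mul_edge_of_ne R h]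
          simp

theorem mk_of_mem_span_pathPairs (g : LeavittGen V) :
    mk (LeavittFree.of R g) ∈ Submodule.span R (pathPairs R V) := by
  have hv : ∀ x : V, vertex R x ∈ Submodule.span R (pathPairs R V) := fun x =>
    Submodule.subset_span ⟨x, x, x, .nil, .nil, (vertex_mul_self R x).symm⟩
  cases g with
  | vertex x => exact hv x
  | edge e =>
    have := gen_mul_mem_span_pathPairs (.edge e) (hv e.right)
    rwa [show mk (LeavittFree.of R _) * _ = _ from edge_mul_vertex_right R e] at this
  | ghost e =>
    have := gen_mul_mem_span_pathPairs (.ghost e) (hv e.left)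
    rwa [show mk (LeavittFree.of R _) * _ = _ from ghost_mul_vertex_left R e] at this

theorem mem_span_pathPairs (x : LeavittPathAlgebra R V) :
    x ∈ Submodule.span R (pathPairs R V) := by
  obtain ⟨x, rfl⟩ := mk_surjective x
  have hw : ∀ m : FreeSemigroup (LeavittGen V),
      mk (MonoidAlgebra.single m (1 : R)) ∈ Submodule.span R (pathPairs R V) := fun m => by
    induction m using FreeSemigroup.recOnMul with
    | ih1 g => exact mk_of_mem_span_pathPairs g
    | ih2 g m _ ih =>
      have := gen_mul_mem_span_pathPairs g ih
      rwa [← mk_mul, LeavittFree.of, MonoidAlgebra.single_mul_single, one_mul] at this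
  induction x using MonoidAlgebra.induction_linear with
  | zero => exact zero_mem _
  | add x y hx hy => rw [mk_add]; exact add_mem hx hy
  | single m r =>
    have := Submodule.smul_mem _ r (hw m)
    rwa [← mk_smul, MonoidAlgebra.smul_single, smul_eq_mul, mul_one] at this

/-- Every element has finitely many nonzero homogeneous components and is their sum. -/
theorem exists_components (x : LeavittPathAlgebra R V) :
    (∀ k, component R V k x ∈ homogeneous R V k) ∧
      ∃ s : Finset ℤ, (∀ k ∉ s, component R V k x = 0) ∧ ∑ k ∈ s, component R V k x = x := by
  -- Demanding the identity for every finite set containing s makes it stable under sums, by taking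
  -- unions. Comparing s with s ∪ {k} recovers the vanishing outside s. The later finite-support
  -- arguments use the same device.
  suffices h : (∀ k, component R V k x ∈ homogeneous R V k) ∧
      ∃ s : Finset ℤ, ∀ t, s ⊆ t → ∑ k ∈ t, component R V k x = x by
    obtain ⟨h, s, hs⟩ := h
    refine ⟨h, s, fun k hk => ?_, hs s subset_rfl⟩
    have := hs (insert k s) (Finset.subset_insert k s)
    rwa [Finset.sum_insert hk, hs s subset_rfl, add_eq_right] at this
  induction mem_span_pathPairs x using Submodule.span_induction with
  | zero => exact ⟨fun k => by rw [map_zero]; exact zero_mem _, ∅, by simp⟩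
  | add x y _ _ hx hy =>
    obtain ⟨hx, s, hs⟩ := hx
    obtain ⟨hy, t, ht⟩ := hy
    refine ⟨fun k => by rw [map_add]; exact add_mem (hx k) (hy k), s ∪ t, fun u hu => ?_⟩
    simp only [map_add, Finset.sum_add_distrib, hs u (Finset.union_subset_left hu),
      ht u (Finset.union_subset_right hu)]
  | smul r x _ hx =>
    obtain ⟨hx, s, hs⟩ := hx
    refine ⟨fun k => by rw [map_smul]; exact Submodule.smul_mem _ _ (hx k), s, fun u hu => ?_⟩
    simp only [map_smul, ← Finset.smul_sum, hs u hu]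
  | mem x h =>
    obtain ⟨a, b, c, α, β, rfl⟩ := h
    have hm : realPath R α * ghostPath R β ∈
        homogeneous R V ((α.length : ℤ) - (β.length : ℤ)) :=
      Submodule.subset_span ⟨a, b, c, α, β, rfl, rfl⟩
    refine ⟨fun k => ?_, {(α.length : ℤ) - (β.length : ℤ)}, fun t ht => ?_⟩
    · rw [component_of_mem hm]
      split
      · next h => rwa [← h]
      · exact zero_mem _
    · simp only [component_of_mem hm, Finset.sum_ite_eq, if_pos (Finset.singleton_subset_iff.1 ht)]

theorem component_mem (k : ℤ) (x : LeavittPathAlgebra R V) :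
    component R V k x ∈ homogeneous R V k :=
  (exists_components x).1 k

/-- No path multiplication is needed: `gradeHom` is multiplicative, so the product equals its own
component of degree k + l. -/
theorem mul_mem_homogeneous {k l : ℤ} {x y : LeavittPathAlgebra R V}
    (hx : x ∈ homogeneous R V k) (hy : y ∈ homogeneous R V l) :
    x * y ∈ homogeneous R V (k + l) := by
  have h : gradeHom R V (x * y) = AddMonoidAlgebra.single (k + l) (Unitization.inr (x * y)) := by
    rw [map_mul, gradeHom_of_mem_homogeneous hx, gradeHom_of_mem_homogeneous hy,
      AddMonoidAlgebra.single_mul_single, Unitization.inr_mul]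
  have := component_mem (k + l) (x * y)
  rwa [component_of_gradeHom h, if_pos rfl] at this

theorem eq_zero_of_component_eq_zero {x : LeavittPathAlgebra R V}
    (h : ∀ k, component R V k x = 0) : x = 0 := by
  obtain ⟨-, s, -, hs⟩ := exists_components x
  rw [← hs]
  exact Finset.sum_eq_zero fun k _ => h k

theorem component_mul_of_mem_left {k : ℤ} {x : LeavittPathAlgebra R V}
    (hx : x ∈ homogeneous R V k) (y : LeavittPathAlgebra R V) (l : ℤ) :
    component R V (k + l) (x * y) = x * component R V l y := by
  obtain ⟨hy, s, hs, hsum⟩ := exists_components y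
  conv_lhs => rw [← hsum]
  simp only [Finset.mul_sum, map_sum, component_of_mem (mul_mem_homogeneous hx (hy _)),
    add_right_inj, Finset.sum_ite_eq']
  split
  · rfl
  · next h => rw [hs l h, mul_zero]

theorem component_mul_of_mem_right {k : ℤ} {y : LeavittPathAlgebra R V}
    (hy : y ∈ homogeneous R V k) (x : LeavittPathAlgebra R V) (l : ℤ) :
    component R V (l + k) (x * y) = component R V l x * y := by
  obtain ⟨hx, s, hs, hsum⟩ := exists_components x
  conv_lhs => rw [← hsum]
  simp only [Finset.sum_mul, map_sum, component_of_mem (mul_mem_homogeneous (hx _) hy),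
    add_left_inj, Finset.sum_ite_eq']
  split
  · rfl
  · next h => rw [hs l h, zero_mul]

end Spanning

/-! ### Reducing a homogeneous element to a multiple of a vertex -/

section Reduction

variable {R : Type u} [CommRing R] {V : Type v} [Quiver.{w} V]

/-- Finite sums of vertices are local units. -/
theorem eq_zero_of_vertex_mul {x : LeavittPathAlgebra R V} (h : ∀ v, vertex R v * x = 0) :
    x = 0 := by
  classical
  suffices ∃ s : Finset V, ∀ t, s ⊆ t → ∑ v ∈ t, vertex R v * x = x by
    obtain ⟨s, hs⟩ := this
    rw [← hs s subset_rfl, Finset.sum_eq_zero fun v _ => h v]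
  clear h
  induction mem_span_pathPairs x using Submodule.span_induction with
  | zero => exact ⟨∅, by simp⟩
  | add x y _ _ hx hy =>
    obtain ⟨s, hs⟩ := hx
    obtain ⟨t, ht⟩ := hy
    refine ⟨s ∪ t, fun u hu => ?_⟩
    simp only [mul_add, Finset.sum_add_distrib, hs u (Finset.union_subset_left hu),
      ht u (Finset.union_subset_right hu)]
  | smul r x _ hx =>
    obtain ⟨s, hs⟩ := hx
    exact ⟨s, fun u hu => by simp only [mul_smul_comm, ← Finset.smul_sum, hs u hu]⟩
  | mem x h =>
    obtain ⟨a, b, c, α, β, rfl⟩ := h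
    refine ⟨{a}, fun t ht => ?_⟩
    rw [Finset.sum_eq_single_of_mem a (ht (Finset.mem_singleton_self a)), ← mul_assoc,
      vertex_mul_realPath]
    intro v _ hv
    rw [← vertex_mul_realPath, ← mul_assoc, ← mul_assoc, vertex_mul_of_ne R hv, zero_mul, zero_mul]

theorem eq_zero_of_mul_vertex {x : LeavittPathAlgebra R V} (h : ∀ v, x * vertex R v = 0) :
    x = 0 := by
  classical
  suffices ∃ s : Finset V, ∀ t, s ⊆ t → ∑ v ∈ t, x * vertex R v = x by
    obtain ⟨s, hs⟩ := this
    rw [← hs s subset_rfl, Finset.sum_eq_zero fun v _ => h v]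
  clear h
  induction mem_span_pathPairs x using Submodule.span_induction with
  | zero => exact ⟨∅, by simp⟩
  | add x y _ _ hx hy =>
    obtain ⟨s, hs⟩ := hx
    obtain ⟨t, ht⟩ := hy
    refine ⟨s ∪ t, fun u hu => ?_⟩
    simp only [add_mul, Finset.sum_add_distrib, hs u (Finset.union_subset_left hu),
      ht u (Finset.union_subset_right hu)]
  | smul r x _ hx =>
    obtain ⟨s, hs⟩ := hx
    exact ⟨s, fun u hu => by simp only [smul_mul_assoc, ← Finset.smul_sum, hs u hu]⟩
  | mem x h =>
    obtain ⟨a, b, c, α, β, rfl⟩ := h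
    refine ⟨{b}, fun t ht => ?_⟩
    rw [Finset.sum_eq_single_of_mem b (ht (Finset.mem_singleton_self b)), mul_assoc,
      ghostPath_mul_vertex]
    intro v _ hv
    rw [← ghostPath_mul_vertex, mul_assoc, mul_assoc, vertex_mul_of_ne R (Ne.symm hv), mul_zero,
      mul_zero]

variable (R V) in
/-- The span of the real paths of length `k`. -/
noncomputable def realSpan (k : ℤ) : Submodule R (LeavittPathAlgebra R V) :=
  Submodule.span R {x | ∃ (a b : V) (p : Quiver.Path a b), (p.length : ℤ) = k ∧ x = realPath R p}

theorem mul_vertex_mem_realSpan {k : ℤ} {y : LeavittPathAlgebra R V} (hy : y ∈ realSpan R V k)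
    (w : V) : y * vertex R w ∈ realSpan R V k := by
  induction hy using Submodule.span_induction with
  | zero => rw [zero_mul]; exact zero_mem _
  | add x y _ _ hx hy => rw [add_mul]; exact add_mem hx hy
  | smul r x _ hx => rw [smul_mul_assoc]; exact Submodule.smul_mem _ _ hx
  | mem x h =>
    obtain ⟨a, b, p, hp, rfl⟩ := h
    rw [← realPath_mul_vertex, mul_assoc]
    obtain h | h := vertex_mul_vertex_eq R b w
    · rw [h, realPath_mul_vertex]
      exact Submodule.subset_span ⟨a, b, p, hp, rfl⟩
    · rw [h, mul_zero]
      exact zero_mem _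

theorem mul_edge_mem_realSpan {k : ℤ} {y : LeavittPathAlgebra R V} (hy : y ∈ realSpan R V k)
    (f : Quiver.Total V) : y * edge R f ∈ realSpan R V (k + 1) := by
  induction hy using Submodule.span_induction with
  | zero => rw [zero_mul]; exact zero_mem _
  | add x y _ _ hx hy => rw [add_mul]; exact add_mem hx hy
  | smul r x _ hx => rw [smul_mul_assoc]; exact Submodule.smul_mem _ _ hx
  | mem x h =>
    obtain ⟨a, b, p, hp, rfl⟩ := h
    obtain ⟨c, d, f⟩ := f
    by_cases h : b = c
    · subst h
      exact Submodule.subset_span ⟨a, d, p.cons f, by simp [hp], rfl⟩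
    · rw [← realPath_mul_vertex, mul_assoc, vertex_mul_edge_of_ne R h, mul_zero]
      exact zero_mem _

theorem ghost_mul_mem_realSpan {n : ℕ} {y : LeavittPathAlgebra R V}
    (hy : y ∈ realSpan R V (n + 1 : ℕ)) (f : Quiver.Total V) :
    ghost R f * y ∈ realSpan R V n := by
  induction hy using Submodule.span_induction with
  | zero => rw [mul_zero]; exact zero_mem _
  | add x y _ _ hx hy => rw [mul_add]; exact add_mem hx hy
  | smul r x _ hx => rw [mul_smul_comm]; exact Submodule.smul_mem _ _ hx
  | mem x h =>
    obtain ⟨a, b, p, hp, rfl⟩ := h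
    obtain ⟨c, e, q, hq, h⟩ := exists_realPath_eq_edge_mul R p (Nat.cast_injective hp)
    rw [h, ← mul_assoc]
    by_cases h : f = ⟨a, c, e⟩
    · rw [h, ghost_mul_edge_self, vertex_mul_realPath]
      exact Submodule.subset_span ⟨c, b, q, by rw [hq], rfl⟩
    · rw [ghost_mul_edge_of_ne R h, zero_mul]
      exact zero_mem _

/-- A combination of paths of positive length is the sum of f f^* y over the finitely many first
edges f that occur. -/
theorem eq_zero_of_ghost_mul {n : ℕ} {y : LeavittPathAlgebra R V}
    (hy : y ∈ realSpan R V (n + 1 : ℕ)) (h : ∀ f, ghost R f * y = 0) : y = 0 := by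
  classical
  suffices ∃ s : Finset (Quiver.Total V), ∀ t, s ⊆ t → ∑ f ∈ t, edge R f * (ghost R f * y) = y by
    obtain ⟨s, hs⟩ := this
    rw [← hs s subset_rfl, Finset.sum_eq_zero fun v _ => by rw [h v, mul_zero]]
  clear h
  induction hy using Submodule.span_induction with
  | zero => exact ⟨∅, by simp⟩
  | add x y _ _ hx hy =>
    obtain ⟨s, hs⟩ := hx
    obtain ⟨t, ht⟩ := hy
    refine ⟨s ∪ t, fun u hu => ?_⟩
    simp only [mul_add, Finset.sum_add_distrib, hs u (Finset.union_subset_left hu),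
      ht u (Finset.union_subset_right hu)]
  | smul r x _ hx =>
    obtain ⟨s, hs⟩ := hx
    exact ⟨s, fun u hu => by simp only [mul_smul_comm, ← Finset.smul_sum, hs u hu]⟩
  | mem x h =>
    obtain ⟨a, b, p, hp, rfl⟩ := h
    obtain ⟨c, e, q, hq, h⟩ := exists_realPath_eq_edge_mul R p (Nat.cast_injective hp)
    refine ⟨{⟨a, c, e⟩}, fun t ht => ?_⟩
    rw [h, Finset.sum_eq_single_of_mem _ (ht (Finset.mem_singleton_self _)), ← mul_assoc (ghost R _),
      ghost_mul_edge_self, vertex_mul_realPath]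
    intro f _ hf
    rw [← mul_assoc (ghost R _), ghost_mul_edge_of_ne R hf, zero_mul, mul_zero]

theorem vertex_mul_of_mem_realSpan_zero {y : LeavittPathAlgebra R V}
    (hy : y ∈ realSpan R V 0) (v : V) : ∃ c : R, vertex R v * y = c • vertex R v := by
  induction hy using Submodule.span_induction with
  | zero => exact ⟨0, by simp⟩
  | add x y _ _ hx hy =>
    obtain ⟨c, hc⟩ := hx
    obtain ⟨d, hd⟩ := hy
    exact ⟨c + d, by rw [mul_add, hc, hd, add_smul]⟩
  | smul r x _ hx =>
    obtain ⟨c, hc⟩ := hx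
    exact ⟨r * c, by rw [mul_smul_comm, hc, mul_smul]⟩
  | mem x h =>
    obtain ⟨a, b, p, hp, rfl⟩ := h
    have hp : p.length = 0 := by exact_mod_cast hp
    obtain rfl := Quiver.Path.eq_of_length_zero p hp
    obtain rfl := Quiver.Path.eq_nil_of_length_zero p hp
    obtain h | h := vertex_mul_vertex_eq R v a
    · exact ⟨1, by rw [realPath, h, one_smul]⟩
    · exact ⟨0, by rw [realPath, h, zero_smul]⟩

/-- Ghost edges on the left strip first edges one at a time, keeping the element nonzero, until only
vertices remain; one vertex then isolates a term. For negative k the span is zero. -/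
theorem exists_mul_eq_smul_vertex_of_mem_realSpan {k : ℤ} {y : LeavittPathAlgebra R V}
    (hy : y ∈ realSpan R V k) (h0 : y ≠ 0) :
    ∃ (a : LeavittPathAlgebra R V) (c : R) (v : V), a * y = c • vertex R v ∧ a * y ≠ 0 := by
  obtain ⟨n, rfl | rfl⟩ := k.eq_nat_or_neg
  · induction n generalizing y with
    | zero =>
      obtain ⟨v, hv⟩ := not_forall.1 (mt eq_zero_of_vertex_mul h0)
      obtain ⟨c, hc⟩ := vertex_mul_of_mem_realSpan_zero hy v
      exact ⟨vertex R v, c, v, hc, hv⟩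
    | succ n ih =>
      obtain ⟨f, hf⟩ := not_forall.1 (mt (eq_zero_of_ghost_mul hy) h0)
      obtain ⟨a, c, v, hc, hv⟩ := ih hf (ghost_mul_mem_realSpan hy f)
      exact ⟨a * ghost R f, c, v, by rw [mul_assoc, hc], by rwa [mul_assoc]⟩
  · obtain rfl | hn := Nat.eq_zero_or_pos n
    · obtain ⟨v, hv⟩ := not_forall.1 (mt eq_zero_of_vertex_mul h0)
      obtain ⟨c, hc⟩ := vertex_mul_of_mem_realSpan_zero (by simpa using hy) v
      exact ⟨vertex R v, c, v, hc, hv⟩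
    · have hs : {x | ∃ (a b : V) (p : Quiver.Path a b), (p.length : ℤ) = -(n : ℤ) ∧
          x = realPath R p} = ∅ := by
        refine Set.eq_empty_of_forall_notMem ?_
        rintro _ ⟨a, b, p, hp, -⟩
        omega
      rw [realSpan, hs, Submodule.span_empty] at hy
      exact (h0 ((Submodule.mem_bot R).1 hy)).elim

/-- Right cancellation of an edge f. Otherwise some a y equals a nonzero c v, and v is the source of
f because y ends there; then c r(f) = f^*(a y)f = 0, which is impossible. -/
theorem eq_zero_of_mul_edge_eq_zero [Countable (Quiver.Total V)] {k : ℤ}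
    {y : LeavittPathAlgebra R V} (hy : y ∈ realSpan R V k) {f : Quiver.Total V}
    (hv : y * vertex R f.left = y) (hf : y * edge R f = 0) : y = 0 := by
  by_contra h0
  obtain ⟨a, c, v, hc, hne⟩ := exists_mul_eq_smul_vertex_of_mem_realSpan hy h0
  have h1 : c • vertex R v = c • (vertex R v * vertex R f.left) := by
    rw [← smul_mul_assoc, ← hc, mul_assoc, hv]
  have h2 : v = f.left := by
    by_contra h
    rw [vertex_mul_of_ne R h, smul_zero, ← hc] at h1
    exact hne h1
  have h3 : c • vertex R f.right = 0 := by
    rw [← ghost_mul_edge_self, ← vertex_left_mul_edge, ← mul_smul_comm, ← smul_mul_assoc, ← h2, ← hc,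
      mul_assoc, hf, mul_zero, mul_zero]
  refine smul_vertex_ne_zero R V (fun hc0 => hne ?_) _ h3
  rw [hc, hc0, zero_smul]

variable (R V) in
/-- The span of the elements `α β^*` of degree `k` for which `β` has length at most `m`. -/
noncomputable def boundedSpan : ℕ → ℤ → Submodule R (LeavittPathAlgebra R V)
  | 0, k => realSpan R V k
  | m + 1, k => realSpan R V k ⊔
      Submodule.span R {x | ∃ z ∈ boundedSpan m (k + 1), ∃ f, x = z * ghost R f}

theorem realSpan_le_boundedSpan (m : ℕ) (k : ℤ) : realSpan R V k ≤ boundedSpan R V m k := by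
  cases m with
  | zero => exact le_rfl
  | succ m => exact le_sup_left

theorem boundedSpan_le_succ (m : ℕ) (k : ℤ) : boundedSpan R V m k ≤ boundedSpan R V (m + 1) k := by
  induction m generalizing k with
  | zero => exact le_sup_left
  | succ m ih =>
    refine sup_le_sup_left (Submodule.span_mono ?_) _
    rintro _ ⟨z, hz, f, rfl⟩
    exact ⟨z, ih _ hz, f, rfl⟩

theorem boundedSpan_mono (k : ℤ) : Monotone fun m => boundedSpan R V m k :=
  monotone_nat_of_le_succ fun m => boundedSpan_le_succ m k

theorem mul_ghost_mem_boundedSpan {m : ℕ} {k : ℤ} {z : LeavittPathAlgebra R V}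
    (hz : z ∈ boundedSpan R V m k) (f : Quiver.Total V) :
    z * ghost R f ∈ boundedSpan R V (m + 1) (k - 1) :=
  le_sup_right (a := realSpan R V (k - 1))
    (Submodule.subset_span ⟨z, by rwa [sub_add_cancel], f, rfl⟩)

theorem mul_vertex_mem_boundedSpan {m : ℕ} {k : ℤ} {z : LeavittPathAlgebra R V}
    (hz : z ∈ boundedSpan R V m k) (w : V) : z * vertex R w ∈ boundedSpan R V m k := by
  cases m with
  | zero => exact mul_vertex_mem_realSpan hz w
  | succ m =>
    obtain ⟨y, hy, t, ht, rfl⟩ := Submodule.mem_sup.1 hz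
    rw [add_mul]
    refine add_mem (realSpan_le_boundedSpan _ _ (mul_vertex_mem_realSpan hy w)) ?_
    clear hz hy
    induction ht using Submodule.span_induction with
    | zero => rw [zero_mul]; exact zero_mem _
    | add x y _ _ hx hy => rw [add_mul]; exact add_mem hx hy
    | smul r x _ hx => rw [smul_mul_assoc]; exact Submodule.smul_mem _ _ hx
    | mem x h =>
      obtain ⟨z, hz, f, rfl⟩ := h
      rw [← ghost_mul_vertex_left, mul_assoc, mul_assoc]
      obtain h | h := vertex_mul_vertex_eq R f.left w
      · rw [h, ghost_mul_vertex_left]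
        simpa using mul_ghost_mem_boundedSpan hz f
      · rw [h, mul_zero, mul_zero]
        exact zero_mem _

theorem mul_ghostPath_mem_boundedSpan {m : ℕ} {k : ℤ} {z : LeavittPathAlgebra R V}
    (hz : z ∈ boundedSpan R V m k) {a b : V} (p : Quiver.Path a b) :
    z * ghostPath R p ∈ boundedSpan R V (m + p.length) (k - p.length) := by
  induction p generalizing z m k with
  | nil => simpa [ghostPath] using mul_vertex_mem_boundedSpan hz a
  | cons p e ih =>
    rw [ghostPath, ← mul_assoc]
    have := ih (mul_ghost_mem_boundedSpan hz ⟨_, _, e⟩)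
    convert this using 2
    · simp [add_assoc, add_comm]
    · simp [sub_sub, add_comm]

theorem exists_mem_boundedSpan {k : ℤ} {x : LeavittPathAlgebra R V}
    (hx : x ∈ homogeneous R V k) : ∃ m, x ∈ boundedSpan R V m k := by
  induction hx using Submodule.span_induction with
  | zero => exact ⟨0, zero_mem _⟩
  | add x y _ _ hx hy =>
    obtain ⟨m, hm⟩ := hx
    obtain ⟨n, hn⟩ := hy
    exact ⟨max m n, add_mem (boundedSpan_mono k (le_max_left _ _) hm)
      (boundedSpan_mono k (le_max_right _ _) hn)⟩
  | smul r x _ hx =>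
    obtain ⟨m, hm⟩ := hx
    exact ⟨m, Submodule.smul_mem _ _ hm⟩
  | mem x h =>
    obtain ⟨a, b, c, α, β, rfl, rfl⟩ := h
    have : realPath R α ∈ boundedSpan R V 0 α.length := Submodule.subset_span ⟨a, c, α, rfl, rfl⟩
    exact ⟨_, mul_ghostPath_mem_boundedSpan this β⟩

theorem mul_edge_mem_boundedSpan {m : ℕ} {k : ℤ} {t : LeavittPathAlgebra R V}
    (ht : t ∈ Submodule.span R {x | ∃ z ∈ boundedSpan R V m (k + 1), ∃ f, x = z * ghost R f})
    (f : Quiver.Total V) :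
    t * edge R f ∈ boundedSpan R V m (k + 1) := by
  induction ht using Submodule.span_induction with
  | zero => rw [zero_mul]; exact zero_mem _
  | add x y _ _ hx hy => rw [add_mul]; exact add_mem hx hy
  | smul r x _ hx => rw [smul_mul_assoc]; exact Submodule.smul_mem _ _ hx
  | mem x h =>
    obtain ⟨z, hz, e, rfl⟩ := h
    rw [mul_assoc]
    by_cases h : e = f
    · rw [h, ghost_mul_edge_self]
      exact mul_vertex_mem_boundedSpan hz _
    · rw [ghost_mul_edge_of_ne R h, mul_zero]
      exact zero_mem _

/-- Only finitely many ghosts occur as last factors in t, and z e^* f f^* is z e^* or 0 according to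
whether e = f. -/
theorem exists_sum_mul_edge_mul_ghost {m : ℕ} {k : ℤ} {t : LeavittPathAlgebra R V}
    (ht : t ∈ Submodule.span R {x | ∃ z ∈ boundedSpan R V m (k + 1), ∃ f, x = z * ghost R f}) :
    ∃ s : Finset (Quiver.Total V),
    (∑ f ∈ s, t * edge R f * ghost R f = t) ∧ ∀ f ∉ s, t * edge R f = 0 := by
  classical
  suffices ∃ s : Finset (Quiver.Total V), ∀ u, s ⊆ u → ∑ f ∈ u, t * edge R f * ghost R f = t by
    obtain ⟨s, hs⟩ := this
    refine ⟨s, hs s subset_rfl, fun f hf => ?_⟩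
    rw [← hs s subset_rfl, Finset.sum_mul]
    refine Finset.sum_eq_zero fun e he => ?_
    have hef : e ≠ f := fun h => hf (h ▸ he)
    rw [mul_assoc, ghost_mul_edge_of_ne R hef, mul_zero]
  induction ht using Submodule.span_induction with
  | zero => exact ⟨∅, by simp⟩
  | add x y _ _ hx hy =>
    obtain ⟨s, hs⟩ := hx
    obtain ⟨t, ht⟩ := hy
    refine ⟨s ∪ t, fun u hu => ?_⟩
    simp only [add_mul, Finset.sum_add_distrib, hs u (Finset.union_subset_left hu),
      ht u (Finset.union_subset_right hu)]
  | smul r x _ hx =>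
    obtain ⟨s, hs⟩ := hx
    exact ⟨s, fun u hu => by simp only [smul_mul_assoc, ← Finset.smul_sum, hs u hu]⟩
  | mem x h =>
    obtain ⟨z, hz, e, rfl⟩ := h
    refine ⟨{e}, fun u hu => ?_⟩
    rw [Finset.sum_eq_single_of_mem e (hu (Finset.mem_singleton_self e)), mul_assoc z,
      ghost_mul_edge_self, mul_assoc, vertex_right_mul_ghost]
    intro f _ hf
    rw [mul_assoc z, ghost_mul_edge_of_ne R (Ne.symm hf), mul_zero, zero_mul]

/-- Induction on the bound m for the ghost length. After cutting down to x = x w, an edge f with x f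
≠ 0 lowers m. If no such edge exists, the shape of the graph at w decides: x must be a combination
of real paths ending at a sink, or else vanish. -/
theorem exists_mul_mul_of_mem_boundedSpan [Countable (Quiver.Total V)] {m : ℕ} {k : ℤ}
    {x : LeavittPathAlgebra R V} (hx : x ∈ boundedSpan R V m k) (h0 : x ≠ 0) :
    ∃ (a b : LeavittPathAlgebra R V) (c : R) (v : V),
      a * x * b = c • vertex R v ∧ a * x * b ≠ 0 := by
  have base : ∀ {k : ℤ} {x : LeavittPathAlgebra R V}, x ∈ realSpan R V k → x ≠ 0 →
      ∃ (a b : LeavittPathAlgebra R V) (c : R) (v : V),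
        a * x * b = c • vertex R v ∧ a * x * b ≠ 0 := fun hx h0 => by
    obtain ⟨a, c, v, h, hne⟩ := exists_mul_eq_smul_vertex_of_mem_realSpan hx h0
    rw [h] at hne
    refine ⟨a, vertex R v, c, v, ?_⟩
    rw [h, smul_mul_assoc, vertex_mul_self]
    exact ⟨rfl, hne⟩
  induction m generalizing k x with
  | zero => exact base hx h0
  | succ m ih =>
    obtain ⟨w, hw⟩ := not_forall.1 (mt eq_zero_of_mul_vertex h0)
    suffices ∃ (a b : LeavittPathAlgebra R V) (c : R) (v : V),
        a * (x * vertex R w) * b = c • vertex R v ∧ a * (x * vertex R w) * b ≠ 0 by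
      obtain ⟨a, b, c, v, h⟩ := this
      exact ⟨a, vertex R w * b, c, v, by simpa only [mul_assoc] using h⟩
    have hx' := mul_vertex_mem_boundedSpan hx w
    have hxw : x * vertex R w * vertex R w = x * vertex R w := by rw [mul_assoc, vertex_mul_self]
    generalize x * vertex R w = x' at hw hx' hxw
    obtain ⟨y, hy, t, ht, rfl⟩ := Submodule.mem_sup.1 hx'
    by_cases hf : ∃ f, (y + t) * edge R f ≠ 0
    · obtain ⟨f, hf⟩ := hf
      have hm : (y + t) * edge R f ∈ boundedSpan R V m (k + 1) := by
        rw [add_mul]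
        exact add_mem (realSpan_le_boundedSpan _ _ (mul_edge_mem_realSpan hy f))
          (mul_edge_mem_boundedSpan ht f)
      obtain ⟨a, b, c, v, h⟩ := ih hm hf
      exact ⟨a, edge R f * b, c, v, by simpa only [mul_assoc] using h⟩
    push Not at hf
    obtain ⟨s, hs, hs'⟩ := exists_sum_mul_edge_mul_ghost ht
    -- If s contains all edges from w, then w emits finitely many: with at least one edge, w = ∑ f
    -- f^* forces x = 0; with none, t w = 0 and x = y w is real.
    by_cases hleft : ∀ f, f.left = w → f ∈ s
    · classical
      by_cases hne : (s.filter fun f => f.left = w).Nonempty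
      · refine absurd ?_ hw
        rw [← hxw, vertex_eq_sum R w _ (fun e => by simpa using hleft e) hne, Finset.mul_sum]
        exact Finset.sum_eq_zero fun f _ => by rw [← mul_assoc, hf, zero_mul]
      · have htw : t * vertex R w = 0 := by
          rw [← hs, Finset.sum_mul]
          refine Finset.sum_eq_zero fun f hfs => ?_
          rw [mul_assoc, ghost_mul_vertex_of_ne R, mul_zero]
          exact fun h => hne ⟨f, Finset.mem_filter.2 ⟨hfs, h⟩⟩
        rw [add_mul, htw, add_zero] at hxw
        rw [← hxw] at hw ⊢
        exact base (mul_vertex_mem_realSpan hy w) hw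
    · push Not at hleft
      obtain ⟨f, rfl, hfs⟩ := hleft
      -- An edge f from w outside s has t f = 0, so y f = 0 and the real part dies by cancellation.
      -- What is left is t w, which every edge kills on the right, so the expansion of t over s
      -- makes it vanish.
      have hyf : y * vertex R f.left = 0 := by
        refine eq_zero_of_mul_edge_eq_zero (mul_vertex_mem_realSpan hy _) (f := f) ?_ ?_
        · rw [mul_assoc, vertex_mul_self]
        · rw [mul_assoc, vertex_left_mul_edge]
          simpa [add_mul, hs' f hfs] using hf f
      refine absurd ?_ hw
      have hye : ∀ e, t * vertex R f.left * edge R e = 0 := fun e => by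
        by_cases h : f.left = e.left
        · have hh := hf e
          rw [← hxw, add_mul y, hyf, zero_add] at hh
          exact hh
        · rw [mul_assoc, vertex_mul_edge_of_ne R h, mul_zero]
      rw [← hxw, add_mul, hyf, zero_add, ← hs, Finset.sum_mul]
      refine Finset.sum_eq_zero fun e he => ?_
      by_cases h : e.left = f.left
      · have hh := hye e
        rw [h.symm, mul_assoc, vertex_left_mul_edge] at hh
        rw [hh, zero_mul, zero_mul]
      · rw [mul_assoc, ghost_mul_vertex_of_ne R h, mul_zero]

/-- A nonzero homogeneous element generates an ideal that contains a nonzero multiple of a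
vertex. -/
theorem exists_mul_mul_eq_smul_vertex [Countable (Quiver.Total V)] {k : ℤ}
    {x : LeavittPathAlgebra R V} (hx : x ∈ homogeneous R V k) (h0 : x ≠ 0) :
    ∃ (a b : LeavittPathAlgebra R V) (c : R) (v : V), a * x * b = c • vertex R v ∧ c ≠ 0 := by
  obtain ⟨m, hm⟩ := exists_mem_boundedSpan hx
  obtain ⟨a, b, c, v, h, hne⟩ := exists_mul_mul_of_mem_boundedSpan hm h0
  exact ⟨a, b, c, v, h, fun hc => hne (by rw [h, hc, zero_smul])⟩

end Reduction

end LeavittPathAlgebra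

/-! ### Annihilator ideals and an elementwise form of primeness -/

namespace TwoSidedIdeal

variable {A : Type*} [NonUnitalRing A]

/-- The left annihilator of the left ideal `A y`. -/
def leftAnnihilator (y : A) : TwoSidedIdeal A :=
  .mk' {z | ∀ a, z * a * y = 0} (fun a => by rw [zero_mul, zero_mul])
    (fun hx hy a => by rw [add_mul, add_mul, hx a, hy a, add_zero])
    (fun hx a => by rw [neg_mul, neg_mul, hx a, neg_zero])
    (fun {x y} hy a => by rw [mul_assoc x, mul_assoc x, hy a, mul_zero])
    (fun {x y} hx a => by rw [mul_assoc x, hx (y * a)])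

theorem mem_leftAnnihilator {y z : A} : z ∈ leftAnnihilator y ↔ ∀ a, z * a * y = 0 :=
  mem_mk' ..

/-- The right annihilator of a two-sided ideal. -/
def rightAnnihilator (I : TwoSidedIdeal A) : TwoSidedIdeal A :=
  .mk' {t | ∀ z ∈ I, z * t = 0} (fun z _ => mul_zero z)
    (fun hx hy z hz => by rw [mul_add, hx z hz, hy z hz, add_zero])
    (fun hx z hz => by rw [mul_neg, hx z hz, neg_zero])
    (fun {x y} hy z hz => by rw [← mul_assoc, hy (z * x) (I.mul_mem_right _ _ hz)])
    (fun {x y} hx z hz => by rw [← mul_assoc, hx z hz, zero_mul])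

theorem mem_rightAnnihilator {I : TwoSidedIdeal A} {t : A} :
    t ∈ I.rightAnnihilator ↔ ∀ z ∈ I, z * t = 0 :=
  mem_mk' ..

theorem mem_rightAnnihilator_leftAnnihilator {u y : A} (h : u * y = y) :
    y ∈ (leftAnnihilator y).rightAnnihilator := by
  refine mem_rightAnnihilator.2 fun z hz => ?_
  rw [← h, ← mul_assoc, mem_leftAnnihilator.1 hz u]

theorem exists_ne_zero_of_ne_bot {I : TwoSidedIdeal A} (h : I ≠ ⊥) : ∃ x ∈ I, x ≠ 0 := by
  by_contra! hI
  exact h (le_bot_iff.1 fun x hx => (mem_bot A).2 (hI x hx))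

end TwoSidedIdeal

/-- The left annihilator of A y and the right annihilator of that ideal have product zero. The first
contains x; the second contains y because y = u y lies in A y, the local unit u replacing a global
one. -/
theorem IsPrimeNonUnitalRing.eq_zero_or_eq_zero {A : Type*} [NonUnitalRing A]
    (hA : IsPrimeNonUnitalRing A) {u x y : A} (hu : u * y = y) (h : ∀ a, x * a * y = 0) :
    x = 0 ∨ y = 0 := by
  have hx := TwoSidedIdeal.mem_leftAnnihilator.2 h
  have hy := TwoSidedIdeal.mem_rightAnnihilator_leftAnnihilator hu
  exact (hA.2 (.leftAnnihilator y) (.rightAnnihilator _) fun a ha b hb =>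
    (TwoSidedIdeal.mem_bot A).2 (TwoSidedIdeal.mem_rightAnnihilator.1 hb a ha)).imp
    (fun h => (TwoSidedIdeal.mem_bot A).1 (h hx)) fun h => (TwoSidedIdeal.mem_bot A).1 (h hy)

/-! ### Torsion-freeness, graded ideals and basic ideals -/

namespace LeavittPathAlgebra

variable {R : Type u} [CommRing R] {V : Type v} [Quiver.{w} V]

/-- A nonzero x (α β^*) y would need α to start at x and β at y, and their shared range would be a
common descendant. -/
theorem vertex_mul_mul_vertex_eq_zero {x y : V}
    (h : ¬ ∃ z : V, Nonempty (Quiver.Path x z) ∧ Nonempty (Quiver.Path y z))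
    (a : LeavittPathAlgebra R V) : vertex R x * a * vertex R y = 0 := by
  induction mem_span_pathPairs a using Submodule.span_induction with
  | zero => rw [mul_zero, zero_mul]
  | add a b _ _ ha hb => rw [mul_add, add_mul, ha, hb, add_zero]
  | smul r a _ ha => rw [mul_smul_comm, smul_mul_assoc, ha, smul_zero]
  | mem a ha =>
    obtain ⟨b, c, d, α, β, rfl⟩ := ha
    rw [← vertex_mul_realPath R α, ← ghostPath_mul_vertex R β]
    by_cases hx : x = b
    · by_cases hy : c = y
      · subst hx hy
        exact (h ⟨d, ⟨α⟩, ⟨β⟩⟩).elim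
      · simp only [mul_assoc, vertex_mul_of_ne R hy, mul_zero]
    · simp only [← mul_assoc, vertex_mul_of_ne R hx, zero_mul]

section

variable [Countable (Quiver.Total V)]

/-- A nonzero component of x would reduce to c v with c ≠ 0, and then (r c) v = 0 with r c ≠ 0. -/
theorem eq_zero_of_smul_eq_zero [IsDomain R] {r : R} (hr : r ≠ 0) {x : LeavittPathAlgebra R V}
    (h : r • x = 0) : x = 0 := by
  refine eq_zero_of_component_eq_zero fun k => ?_
  by_contra hk
  obtain ⟨a, b, c, v, hc, hc0⟩ := exists_mul_mul_eq_smul_vertex (component_mem k x) hk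
  refine smul_vertex_ne_zero R V (mul_ne_zero hr hc0) v ?_
  rw [mul_smul, ← hc, ← smul_mul_assoc, ← mul_smul_comm, ← map_smul, h, map_zero, mul_zero, zero_mul]

theorem vertex_ne_zero [Nontrivial R] (x : V) : vertex R x ≠ 0 := fun h =>
  smul_vertex_ne_zero R V one_ne_zero x (by rw [h, smul_zero])

end

theorem isGradedIdeal_of_component_mem {I : TwoSidedIdeal (LeavittPathAlgebra R V)}
    (h : ∀ x ∈ I, ∀ k, component R V k x ∈ I) : IsGradedIdeal I := by
  classical
  intro x hx
  obtain ⟨hc, s, hs, hsum⟩ := exists_components x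
  refine ⟨Finsupp.onFinset s (fun k => component R V k x) fun k hk => by
    by_contra hks; exact hk (hs k hks), ⟨fun k => ⟨h x hx k, hc k⟩, ?_⟩, ?_⟩
  · rw [Finsupp.onFinset_sum _ fun _ => rfl, hsum]
  · rintro f ⟨hf, rfl⟩
    ext k
    rw [Finsupp.onFinset_apply, Finsupp.sum, map_sum]
    simp only [component_of_mem (hf _).2, Finset.sum_ite_eq', Finsupp.mem_support_iff]
    split
    · rfl
    · next h => exact not_not.1 h

/-- For homogeneous a and y, the product of a component of x with a y is a component of x a y = 0.
-/
theorem isGradedIdeal_leftAnnihilator {y : LeavittPathAlgebra R V} {n : ℤ}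
    (hy : y ∈ homogeneous R V n) : IsGradedIdeal (TwoSidedIdeal.leftAnnihilator y) := by
  refine isGradedIdeal_of_component_mem fun x hx k => TwoSidedIdeal.mem_leftAnnihilator.2 fun a => ?_
  obtain ⟨-, s, -, hs⟩ := exists_components a
  rw [← hs, Finset.mul_sum, Finset.sum_mul]
  refine Finset.sum_eq_zero fun l _ => ?_
  rw [mul_assoc, ← component_mul_of_mem_right (mul_mem_homogeneous (component_mem l a) hy),
    ← mul_assoc, TwoSidedIdeal.mem_leftAnnihilator.1 hx, map_zero]

theorem IsGradedIdeal.component_mem {I : TwoSidedIdeal (LeavittPathAlgebra R V)}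
    (hI : IsGradedIdeal I) {x : LeavittPathAlgebra R V} (hx : x ∈ I) (k : ℤ) :
    component R V k x ∈ I := by
  classical
  obtain ⟨f, ⟨hf, rfl⟩, -⟩ := hI x hx
  rw [Finsupp.sum, map_sum]
  simp only [component_of_mem (hf _).2, Finset.sum_ite_eq']
  split
  · exact (hf k).1
  · exact I.zero_mem

theorem IsGradedIdeal.rightAnnihilator {I : TwoSidedIdeal (LeavittPathAlgebra R V)}
    (hI : IsGradedIdeal I) : IsGradedIdeal I.rightAnnihilator := by
  refine isGradedIdeal_of_component_mem fun y hy k =>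
    TwoSidedIdeal.mem_rightAnnihilator.2 fun z hz => ?_
  obtain ⟨hz', s, -, hs⟩ := exists_components z
  rw [← hs, Finset.sum_mul]
  refine Finset.sum_eq_zero fun l _ => ?_
  rw [← component_mul_of_mem_left (hz' l),
    TwoSidedIdeal.mem_rightAnnihilator.1 hy _ (hI.component_mem hz l), map_zero]

theorem isBasicIdeal_of_smul_mem {I : TwoSidedIdeal (LeavittPathAlgebra R V)}
    (h : ∀ r : R, r ≠ 0 → ∀ x, r • x ∈ I → x ∈ I) : IsBasicIdeal I :=
  fun r hr _ => ⟨h r hr _, fun _ _ => h r hr _⟩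

theorem isBasicIdeal_leftAnnihilator [IsDomain R] [Countable (Quiver.Total V)]
    (y : LeavittPathAlgebra R V) : IsBasicIdeal (R := R) (TwoSidedIdeal.leftAnnihilator y) :=
  isBasicIdeal_of_smul_mem fun r hr x hx => TwoSidedIdeal.mem_leftAnnihilator.2 fun a =>
    eq_zero_of_smul_eq_zero hr <| by
      rw [← smul_mul_assoc, ← smul_mul_assoc, TwoSidedIdeal.mem_leftAnnihilator.1 hx]

theorem isBasicIdeal_rightAnnihilator [IsDomain R] [Countable (Quiver.Total V)]
    (I : TwoSidedIdeal (LeavittPathAlgebra R V)) : IsBasicIdeal (R := R) I.rightAnnihilator :=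
  isBasicIdeal_of_smul_mem fun r hr x hx => TwoSidedIdeal.mem_rightAnnihilator.2 fun z hz =>
    eq_zero_of_smul_eq_zero hr <| by
      rw [← mul_smul_comm, TwoSidedIdeal.mem_rightAnnihilator.1 hx z hz]

/-! ### Top components and primeness under (MT3) -/

theorem exists_top_component {x : LeavittPathAlgebra R V} (hx : x ≠ 0) :
    ∃ m, component R V m x ≠ 0 ∧ ∀ k, m < k → component R V k x = 0 := by
  classical
  obtain ⟨-, s, hs, -⟩ := exists_components x
  have hne : (s.filter fun k => component R V k x ≠ 0).Nonempty := by
    by_contra h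
    refine hx (eq_zero_of_component_eq_zero fun k => ?_)
    by_contra hk
    refine h ⟨k, Finset.mem_filter.2 ⟨?_, hk⟩⟩
    by_contra hks
    exact hk (hs k hks)
  refine ⟨_, (Finset.mem_filter.1 (Finset.max'_mem _ hne)).2, fun k hk => ?_⟩
  by_contra h
  have hks : k ∈ s := by
    by_contra hks
    exact h (hs k hks)
  exact hk.not_ge (Finset.le_max' _ k (Finset.mem_filter.2 ⟨hks, h⟩))

theorem component_mul_of_top {m n : ℤ} {x y : LeavittPathAlgebra R V}
    (hx : ∀ k, m < k → component R V k x = 0) (hy : ∀ k, n < k → component R V k y = 0) :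
    component R V (m + n) (x * y) = component R V m x * component R V n y := by
  obtain ⟨hc, s, hs, hsum⟩ := exists_components x
  have key : ∀ k, component R V (m + n) (component R V k x * y) =
      component R V k x * component R V (m + n - k) y := fun k => by
    rw [← component_mul_of_mem_left (hc k), add_sub_cancel]
  conv_lhs => rw [← hsum, Finset.sum_mul, map_sum]
  simp only [key]
  rw [Finset.sum_eq_single m, add_sub_cancel_left]
  · intro k _ hk
    obtain hk | hk := lt_or_gt_of_ne hk
    · rw [hy _ (by omega), mul_zero]
    · rw [hx k hk, zero_mul]
  · intro hm
    rw [hs m hm, zero_mul]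

theorem top_mul_mul_top_eq_zero {m n : ℤ} {x y : LeavittPathAlgebra R V}
    (hx : ∀ k, m < k → component R V k x = 0) (hy : ∀ k, n < k → component R V k y = 0)
    (h : ∀ a, x * a * y = 0) (a : LeavittPathAlgebra R V) :
    component R V m x * a * component R V n y = 0 := by
  obtain ⟨ha, s, -, hs⟩ := exists_components a
  rw [← hs, Finset.mul_sum, Finset.sum_mul]
  refine Finset.sum_eq_zero fun d _ => ?_
  -- For a of degree d, the product x_m a is the component of x a in degree m + d, above which x a
  -- has none; so x_m a y_n is a component of x a y.
  rw [← component_mul_of_mem_right (ha d), ← component_mul_of_top (fun k hk => ?_) hy, h, map_zero]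
  rw [← sub_add_cancel k d, component_mul_of_mem_right (ha d), hx _ (by omega), zero_mul]

theorem exists_mul_mul_ne_zero [IsDomain R] [Countable (Quiver.Total V)] (hV : ConditionMT3 V)
    {x y : LeavittPathAlgebra R V} (hx : x ≠ 0) (hy : y ≠ 0) : ∃ a, x * a * y ≠ 0 := by
  by_contra! h
  obtain ⟨m, hm, hmx⟩ := exists_top_component hx
  obtain ⟨n, hn, hny⟩ := exists_top_component hy
  have h0 := top_mul_mul_top_eq_zero hmx hny h
  obtain ⟨a, b, c, v, hc, hc0⟩ := exists_mul_mul_eq_smul_vertex (component_mem m x) hm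
  obtain ⟨a', b', d, w, hd, hd0⟩ := exists_mul_mul_eq_smul_vertex (component_mem n y) hn
  obtain ⟨z, ⟨p⟩, ⟨q⟩⟩ := hV v w
  have h1 : (c • vertex R v) * (realPath R p * ghostPath R q) * (d • vertex R w) = 0 := by
    rw [← hc, ← hd]
    have := congrArg (fun t => a * t * b') (h0 (b * (realPath R p * ghostPath R q) * a'))
    simpa only [mul_assoc, mul_zero, zero_mul] using this
  rw [smul_mul_assoc, mul_smul_comm, smul_mul_assoc, mul_assoc, mul_assoc, ghostPath_mul_vertex,
    ← mul_assoc, vertex_mul_realPath, smul_smul] at h1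
  -- Multiplying by p^* and q collapses p q^* to the common vertex z, leaving a nonzero scalar
  -- multiple of z.
  have h2 := congrArg (fun t => ghostPath R p * t * realPath R q) h1
  simp only [mul_smul_comm, smul_mul_assoc, mul_zero, zero_mul] at h2
  rw [mul_assoc, mul_assoc, ghostPath_mul_realPath_self, realPath_mul_vertex,
    ghostPath_mul_realPath_self] at h2
  exact smul_vertex_ne_zero R V (mul_ne_zero hd0 hc0) z h2

theorem isPrimeNonUnitalRing_of_conditionMT3 [IsDomain R] [Countable (Quiver.Total V)] [Nonempty V]
    (hV : ConditionMT3 V) : IsPrimeNonUnitalRing (LeavittPathAlgebra R V) := by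
  refine ⟨fun h => ?_, fun I J hIJ => ?_⟩
  · obtain ⟨x⟩ := ‹Nonempty V›
    refine vertex_ne_zero (R := R) x ((TwoSidedIdeal.mem_bot _).1 ?_)
    rw [h]
    exact TwoSidedIdeal.mem_top _
  · by_contra! h
    obtain ⟨x, hx, hx0⟩ := TwoSidedIdeal.exists_ne_zero_of_ne_bot (mt (fun h => h.le) h.1)
    obtain ⟨y, hy, hy0⟩ := TwoSidedIdeal.exists_ne_zero_of_ne_bot (mt (fun h => h.le) h.2)
    obtain ⟨a, ha⟩ := exists_mul_mul_ne_zero hV hx0 hy0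
    exact ha ((TwoSidedIdeal.mem_bot _).1 (hIJ _ (I.mul_mem_right _ _ hx) y hy))

/-! ### Consequences of primeness and of the condition on graded basic ideals -/

theorem isDomain_of_isPrimeNonUnitalRing [Countable (Quiver.Total V)] [Nonempty V]
    (h : IsPrimeNonUnitalRing (LeavittPathAlgebra R V)) : IsDomain R := by
  have : Nontrivial R := by
    by_contra hR
    rw [not_nontrivial_iff_subsingleton] at hR
    have := Module.subsingleton R (LeavittPathAlgebra R V)
    refine h.1 (le_antisymm bot_le fun x _ => ?_)
    rw [Subsingleton.elim x 0]
    exact TwoSidedIdeal.zero_mem _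
  have : NoZeroDivisors R := ⟨fun {r s} hrs => by
    obtain ⟨x⟩ := ‹Nonempty V›
    by_contra! hne
    obtain h | h := h.eq_zero_or_eq_zero (u := vertex R x) (x := r • vertex R x)
      (y := s • vertex R x) (by rw [mul_smul_comm, vertex_mul_self])
      (fun a => by rw [mul_smul_comm, smul_mul_assoc, smul_mul_assoc, smul_smul, mul_comm, hrs,
        zero_smul])
    · exact smul_vertex_ne_zero R V hne.1 x h
    · exact smul_vertex_ne_zero R V hne.2 x h⟩
  exact NoZeroDivisors.to_isDomain R

theorem conditionMT3_of_isPrimeNonUnitalRing [Nontrivial R] [Countable (Quiver.Total V)]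
    (h : IsPrimeNonUnitalRing (LeavittPathAlgebra R V)) : ConditionMT3 V := by
  intro x y
  by_contra hxy
  obtain h | h := h.eq_zero_or_eq_zero (vertex_mul_self R y) (vertex_mul_mul_vertex_eq_zero hxy)
  · exact vertex_ne_zero x h
  · exact vertex_ne_zero y h

/-- For a path p from x to y, y = p^* x p. -/
theorem vertex_mem_of_path {I : TwoSidedIdeal (LeavittPathAlgebra R V)} {x y : V}
    (p : Quiver.Path x y) (hx : vertex R x ∈ I) : vertex R y ∈ I := by
  rw [← ghostPath_mul_realPath_self R p, ← vertex_mul_realPath]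
  exact I.mul_mem_left _ _ (I.mul_mem_right _ _ hx)

theorem exists_vertex_mem [Countable (Quiver.Total V)]
    {I : TwoSidedIdeal (LeavittPathAlgebra R V)} (hg : IsGradedIdeal I) (hb : IsBasicIdeal I)
    (h0 : I ≠ ⊥) : ∃ x, vertex R x ∈ I := by
  obtain ⟨x, hx, hx0⟩ := TwoSidedIdeal.exists_ne_zero_of_ne_bot h0
  obtain ⟨k, hk⟩ := not_forall.1 (mt eq_zero_of_component_eq_zero hx0)
  obtain ⟨a, b, c, v, h, hc⟩ := exists_mul_mul_eq_smul_vertex (component_mem k x) hk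
  refine ⟨v, (hb c hc v).1 ?_⟩
  rw [← h]
  exact I.mul_mem_right _ _ (I.mul_mem_left _ _ (hg.component_mem hx k))

theorem vertex_mem_homogeneous (x : V) : vertex R x ∈ homogeneous R V 0 :=
  Submodule.subset_span ⟨x, x, x, .nil, .nil, by simp, (vertex_mul_self R x).symm⟩

theorem conditionMT3_of_forall_graded_basic [IsDomain R] [Countable (Quiver.Total V)]
    (h : ∀ I J : TwoSidedIdeal (LeavittPathAlgebra R V),
      IsGradedIdeal I → IsBasicIdeal I → I ≠ ⊥ → IsGradedIdeal J → IsBasicIdeal J → J ≠ ⊥ →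
      ((I : Set (LeavittPathAlgebra R V)) ∩ (J : Set (LeavittPathAlgebra R V)) ∩
        Set.range (vertex R : V → LeavittPathAlgebra R V)).Nonempty) : ConditionMT3 V := by
  intro x y
  by_contra hxy
  have hne : ∀ {I : TwoSidedIdeal (LeavittPathAlgebra R V)} {z : V}, vertex R z ∈ I → I ≠ ⊥ :=
    fun hz hI => vertex_ne_zero _ ((TwoSidedIdeal.mem_bot _).1 (hI ▸ hz))
  -- The two ideals are {z : z A y = 0}, which contains x, and its right annihilator, which contains
  -- y. A vertex in both squares to zero.
  have hI := isGradedIdeal_leftAnnihilator (vertex_mem_homogeneous (R := R) y)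
  obtain ⟨_, ⟨h₁, h₂⟩, z, rfl⟩ := h _ _ hI (isBasicIdeal_leftAnnihilator _)
    (hne (TwoSidedIdeal.mem_leftAnnihilator.2 (vertex_mul_mul_vertex_eq_zero hxy)))
    hI.rightAnnihilator (isBasicIdeal_rightAnnihilator _)
    (hne (TwoSidedIdeal.mem_rightAnnihilator_leftAnnihilator (vertex_mul_self R y)))
  refine vertex_ne_zero (R := R) z ?_
  rw [← vertex_mul_self]
  exact TwoSidedIdeal.mem_rightAnnihilator.1 h₂ _ h₁

end LeavittPathAlgebra

theorem proposition4p4 (R : Type u) [CommRing R] (V : Type v) [Quiver.{w} V]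
    [Countable V] [Countable (Quiver.Total V)] [Nonempty V] :
    List.TFAE [
      IsPrimeNonUnitalRing (LeavittPathAlgebra R V),
      IsDomain R ∧ ConditionMT3 V,
      IsDomain R ∧ ∀ I J : TwoSidedIdeal (LeavittPathAlgebra R V),
        LeavittPathAlgebra.IsGradedIdeal I → LeavittPathAlgebra.IsBasicIdeal I → I ≠ ⊥ →
        LeavittPathAlgebra.IsGradedIdeal J → LeavittPathAlgebra.IsBasicIdeal J → J ≠ ⊥ →
        ((I : Set (LeavittPathAlgebra R V)) ∩ (J : Set (LeavittPathAlgebra R V)) ∩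
          Set.range (LeavittPathAlgebra.vertex R : V → LeavittPathAlgebra R V)).Nonempty] := by
  tfae_have 1 → 2 := fun h => by
    have := LeavittPathAlgebra.isDomain_of_isPrimeNonUnitalRing h
    exact ⟨this, LeavittPathAlgebra.conditionMT3_of_isPrimeNonUnitalRing h⟩
  tfae_have 2 → 1 := fun ⟨_, h⟩ => LeavittPathAlgebra.isPrimeNonUnitalRing_of_conditionMT3 h
  tfae_have 2 → 3 := fun ⟨hR, hV⟩ => ⟨hR, fun I J hIg hIb hI hJg hJb hJ => by
    obtain ⟨x, hx⟩ := LeavittPathAlgebra.exists_vertex_mem hIg hIb hI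
    obtain ⟨y, hy⟩ := LeavittPathAlgebra.exists_vertex_mem hJg hJb hJ
    obtain ⟨z, ⟨p⟩, ⟨q⟩⟩ := hV x y
    exact ⟨_, ⟨LeavittPathAlgebra.vertex_mem_of_path p hx,
      LeavittPathAlgebra.vertex_mem_of_path q hy⟩, z, rfl⟩⟩
  tfae_have 3 → 2 := fun ⟨hR, h⟩ => ⟨hR, LeavittPathAlgebra.conditionMT3_of_forall_graded_basic h⟩
  tfae_finish
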